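/- A Euclidean lattice of rank $\ell$ is the $\mathbb{Z}$-span of an $\mathbb{R}$-basis of a Euclidean space of dimension $\ell$. Let $L$ be such a lattice and $S(L)$ its set of minimal vectors (nonzero vectors of shortest length). If $\mathcal{B}$ is a $\mathbb{Z}$-basis of $L$ and $X\in\mathbb{Z}^{\ell}$ denotes the column of coordinates of $x\in S(L)$ on $\mathcal{B}$, the rank of perfection $r_{\mathrm{perf}}(L)$ is the dimension of the real span of the matrices $XX^{t}$, $x\in S(L)$ (it does not depend on $\mathcal{B}$). The lattice $L$ is called perfect if $r_{\mathrm{perf}}(L)=\ell(\ell+1)/2$, and extreme if the density of the associated sphere packing (equal balls of radius half the minimal length, centred at the lattice points) has a local maximum at $L$ among the rank $\ell$ lattices of the Euclidean space. Let $L$ and $M$ be Euclidean lattices, both of rank at least $2$, and let $L\otimes_{\mathbb{Z}}M$ be their tensor product, a Euclidean lattice for the inner product determined by $(x\otimes y)\cdot(z\otimes t)=(x\cdot z)(y\cdot t)$. If $\operatorname{rank} L\leq 43$ or $\operatorname{rank} M\leq 43$, then $L\otimes_{\mathbb{Z}}M$ is not perfect, and is not extreme. -/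

import Mathlib

open MeasureTheory Module TensorProduct

namespace EuclideanLattice

noncomputable section

section General

variable {E : Type*} [NormedAddCommGroup E] [InnerProductSpace ℝ E]

/-- The minimal vectors of `L`: its nonzero vectors of shortest length. -/
def minimalVectors (L : Submodule ℤ E) : Set L :=
  {x | x ≠ 0 ∧ ∀ y : L, y ≠ 0 → ‖x‖ ≤ ‖y‖}

/-- The real column vector of the integral coordinates of `x` on a `ℤ`-basis `b` of `L`. -/
def coordVec {L : Submodule ℤ E} {ι : Type*} (b : Basis ι ℤ L) (x : L) : ι → ℝ :=
  fun i => (b.repr x i : ℝ)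

/-- The real span of the matrices `X Xᵗ`, where `X` runs through the coordinate columns, on the
`ℤ`-basis `b`, of the minimal vectors of `L`. -/
def perfectionSpan {L : Submodule ℤ E} {ι : Type*} (b : Basis ι ℤ L) :
    Submodule ℝ (Matrix ι ι ℝ) :=
  Submodule.span ℝ
    ((fun x : L => Matrix.vecMulVec (coordVec b x) (coordVec b x)) '' minimalVectors L)

/-- The rank of perfection of a lattice (see `perfectionRank_eq` for the independence of
the basis). -/
def perfectionRank [FiniteDimensional ℝ E] (L : Submodule ℤ E) [DiscreteTopology L] : ℕ :=
  finrank ℝ (perfectionSpan (Module.finBasis ℤ L))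

/-- A lattice of rank `ℓ` is perfect if its rank of perfection is `ℓ (ℓ + 1) / 2`. -/
def IsPerfect [FiniteDimensional ℝ E] (L : Submodule ℤ E) [DiscreteTopology L] : Prop :=
  perfectionRank L = finrank ℤ L * (finrank ℤ L + 1) / 2

/-- The length of a shortest nonzero vector of `L`. -/
def minNorm (L : Submodule ℤ E) : ℝ :=
  sInf {r : ℝ | ∃ x ∈ L, x ≠ 0 ∧ ‖x‖ = r}

/-- The density of the sphere packing attached to a (full) lattice `L` of a Euclidean space:
the balls have radius half the minimal length, and there is one ball for each fundamental domain.
The volume is the Lebesgue measure of the Euclidean space. -/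
def density [FiniteDimensional ℝ E] (L : Submodule ℤ E) : ℝ :=
  letI : MeasurableSpace E := borel E
  haveI : BorelSpace E := ⟨rfl⟩
  (volume : Measure E).real (Metric.ball 0 (minNorm L / 2)) / ZLattice.covolume L volume

/-- A lattice is extreme if it achieves a local maximum of the density. The lattices close to `L`
are the images of `L` under the linear maps close to the identity. -/
def IsExtreme [FiniteDimensional ℝ E] (L : Submodule ℤ E) : Prop :=
  IsLocalMax (fun g : E →L[ℝ] E => density (L.map (g.toLinearMap.restrictScalars ℤ)))
    (ContinuousLinearMap.id ℝ E)

theorem coordVec_basis_change {L : Submodule ℤ E} {ι κ : Type*} [Fintype ι] [Fintype κ]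
    (b : Basis ι ℤ L) (c : Basis κ ℤ L) (x : L) :
    coordVec c x = ((c.toMatrix b).map (Int.cast : ℤ → ℝ)).mulVec (coordVec b x) := by
  ext k
  have h := b.toMatrix_mulVec_repr c x
  have hk := congrFun h k
  simp only [coordVec, ← hk, Matrix.mulVec, dotProduct, Matrix.map_apply]
  push_cast
  rfl

theorem finrank_perfectionSpan_le {L : Submodule ℤ E} {ι κ : Type*} [Fintype ι] [Fintype κ]
    (b : Basis ι ℤ L) (c : Basis κ ℤ L) :
    finrank ℝ (perfectionSpan c) ≤ finrank ℝ (perfectionSpan b) := by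
  set P : Matrix κ ι ℝ := (c.toMatrix b).map (Int.cast : ℤ → ℝ) with hP
  let f : Matrix ι ι ℝ →ₗ[ℝ] Matrix κ κ ℝ :=
    { toFun := fun A => P * A * P.transpose
      map_add' := fun A B => by rw [Matrix.mul_add, Matrix.add_mul]
      map_smul' := fun r A => by rw [Matrix.mul_smul, Matrix.smul_mul, RingHom.id_apply] }
  have : perfectionSpan c = (perfectionSpan b).map f := by
    rw [perfectionSpan, perfectionSpan, Submodule.map_span, ← Set.image_comp]
    congr 1
    apply Set.image_congr
    intro x _
    simp only [Function.comp, f, LinearMap.coe_mk, AddHom.coe_mk]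
    rw [coordVec_basis_change b c x, Matrix.mul_vecMulVec, Matrix.vecMulVec_mul,
      Matrix.vecMul_transpose]
  rw [this]
  exact Submodule.finrank_map_le f _

/-- The rank of perfection can be computed on any basis of the lattice. -/
theorem perfectionRank_eq [FiniteDimensional ℝ E] (L : Submodule ℤ E) [DiscreteTopology L]
    {ι : Type*} [Fintype ι] (b : Basis ι ℤ L) :
    perfectionRank L = finrank ℝ (perfectionSpan b) :=
  le_antisymm (finrank_perfectionSpan_le _ _) (finrank_perfectionSpan_le _ _)

end General

section Tensor

variable {E F : Type*} [NormedAddCommGroup E] [InnerProductSpace ℝ E]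
  [NormedAddCommGroup F] [InnerProductSpace ℝ F]

/-- The bilinear map `(x, y) ↦ x ⊗ y` from `L × M` to `E ⊗ F`. -/
def tensorBilin (L : Submodule ℤ E) (M : Submodule ℤ F) : L →ₗ[ℤ] M →ₗ[ℤ] E ⊗[ℝ] F :=
  LinearMap.mk₂ ℤ (fun (x : L) (y : M) => (x : E) ⊗ₜ[ℝ] (y : F))
    (fun x x' y => by simp [TensorProduct.add_tmul])
    (fun n x y => by
      simp only [Submodule.coe_smul, ← Int.cast_smul_eq_zsmul ℝ, TensorProduct.smul_tmul'])
    (fun x y y' => by simp [TensorProduct.tmul_add])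
    (fun n x y => by
      simp only [Submodule.coe_smul, ← Int.cast_smul_eq_zsmul ℝ, TensorProduct.tmul_smul])

/-- The canonical map `L ⊗ M → E ⊗ F`, `x ⊗ y ↦ x ⊗ y`, from the tensor product over `ℤ` to
the tensor product over `ℝ`. -/
def tensorMap (L : Submodule ℤ E) (M : Submodule ℤ F) : L ⊗[ℤ] M →+ E ⊗[ℝ] F :=
  (TensorProduct.lift (tensorBilin L M)).toAddMonoidHom

@[simp]
theorem tensorMap_tmul (L : Submodule ℤ E) (M : Submodule ℤ F) (x : L) (y : M) :
    tensorMap L M (x ⊗ₜ[ℤ] y) = (x : E) ⊗ₜ[ℝ] (y : F) := rfl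

/-- The Euclidean lattice `L ⊗ M` (tensor product over `ℤ`), realised in the Euclidean space
`E ⊗ F`, with the inner product such that `⟪x ⊗ y, z ⊗ t⟫ = ⟪x, z⟫ * ⟪y, t⟫`, through the
canonical map. This map is injective: see `tensorMap_injective`. -/
def tensorLattice (L : Submodule ℤ E) (M : Submodule ℤ F) : Submodule ℤ (E ⊗[ℝ] F) :=
  AddSubgroup.toIntSubmodule (tensorMap L M).range

variable [FiniteDimensional ℝ E] [FiniteDimensional ℝ F]
  (L : Submodule ℤ E) [DiscreteTopology L] [IsZLattice ℝ L]
  (M : Submodule ℤ F) [DiscreteTopology M] [IsZLattice ℝ M]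

theorem tensorMap_eq_sum {ι κ : Type*} [Fintype ι] [Fintype κ] (b : Basis ι ℤ L)
    (c : Basis κ ℤ M) (z : L ⊗[ℤ] M) :
    tensorMap L M z = ∑ p, (b.tensorProduct c).repr z p •
      ((b.ofZLatticeBasis ℝ L).tensorProduct (c.ofZLatticeBasis ℝ M)) p := by
  change TensorProduct.lift (tensorBilin L M) z = _
  conv_lhs => rw [← (b.tensorProduct c).sum_repr z]
  rw [map_sum]
  refine Finset.sum_congr rfl fun p _ => ?_
  rw [map_smul]
  congr 1
  rw [Basis.tensorProduct_apply', Basis.tensorProduct_apply', Basis.ofZLatticeBasis_apply,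
    Basis.ofZLatticeBasis_apply]
  rfl

theorem tensorMap_injective : Function.Injective (tensorMap L M) := by
  let b := Module.finBasis ℤ L
  let c := Module.finBasis ℤ M
  let B := (b.ofZLatticeBasis ℝ L).tensorProduct (c.ofZLatticeBasis ℝ M)
  rw [injective_iff_map_eq_zero]
  intro z hz
  rw [tensorMap_eq_sum L M b c] at hz
  have h := Fintype.linearIndependent_iff.1 B.linearIndependent
    (fun p => ((b.tensorProduct c).repr z p : ℝ))
    (by simpa only [Int.cast_smul_eq_zsmul] using hz)
  apply (b.tensorProduct c).ext_elem
  intro p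
  simpa using h p

theorem tensorLattice_eq_span {ι κ : Type*} [Fintype ι] [Fintype κ] (b : Basis ι ℤ L)
    (c : Basis κ ℤ M) :
    tensorLattice L M = Submodule.span ℤ
      (Set.range ((b.ofZLatticeBasis ℝ L).tensorProduct (c.ofZLatticeBasis ℝ M))) := by
  apply le_antisymm
  · rintro _ ⟨z, rfl⟩
    rw [tensorMap_eq_sum L M b c]
    exact Submodule.sum_mem _ fun p _ =>
      Submodule.smul_mem _ _ (Submodule.subset_span (Set.mem_range_self p))
  · rw [Submodule.span_le]
    rintro _ ⟨p, rfl⟩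
    refine ⟨b p.1 ⊗ₜ[ℤ] c p.2, ?_⟩
    rw [Basis.tensorProduct_apply', Basis.ofZLatticeBasis_apply, Basis.ofZLatticeBasis_apply]
    rfl

instance instDiscreteTopologyTensorLattice : DiscreteTopology (tensorLattice L M) := by
  rw [tensorLattice_eq_span L M (Module.finBasis ℤ L) (Module.finBasis ℤ M)]
  infer_instance

instance instIsZLatticeTensorLattice : IsZLattice ℝ (tensorLattice L M) where
  span_top := by
    rw [tensorLattice_eq_span L M (Module.finBasis ℤ L) (Module.finBasis ℤ M)]
    exact ZSpan.span_top _

end Tensor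

end

end EuclideanLattice

/-! Everything rests on Kitaoka's theorem (`exists_eq_tmul_of_mem_minimalVectors`): the minimal
vectors of `L ⊗ M` are split tensors. Write such a vector as `∑ xᵢ ⊗ yᵢ` with the fewest terms `r`;
both families are then independent, so `r` is at most either rank. The squared norm is the trace of
the product of the two Gram matrices, hence at least `r (det det)^(1/r)` by AM-GM. Blichfeldt's
bound estimates the determinants from below, and for `2 ≤ r ≤ 43` the result exceeds the squared
norm of `x₀ ⊗ y₀`, with `x₀`, `y₀` minimal in `L`, `M`.

Split tensors satisfy a quadratic equation, the vanishing of a `2 × 2` minor. Read on the matrices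
`X Xᵗ`, it is a linear relation that rules out perfection. Read as a quadratic form `⟪z, N z⟫`, it
gives a deformation `1 + a N` that shortens no minimal vector and decreases the covolume; this
excludes extremality directly, without passing through perfection. -/

namespace EuclideanLattice

/-! ### Blichfeldt's lower bound for the covolume. -/

section Blichfeldt

open scoped ENNReal

variable {V : Type*} [NormedAddCommGroup V] [InnerProductSpace ℝ V]

/-- The double sum of `‖vᵢ - vⱼ‖²` equals `2k ∑ ‖vᵢ‖² - 2 ‖∑ vᵢ‖²`, where `k` is the number of
points. -/
theorem card_mul_card_sub_one_mul_le {ι : Type*} (s : Finset ι) (v : ι → V) {m : ℝ}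
    (h : ∀ i ∈ s, ∀ j ∈ s, i ≠ j → m ≤ ‖v i - v j‖ ^ 2) :
    (s.card : ℝ) * (s.card - 1) * m ≤ 2 * s.card * ∑ i ∈ s, ‖v i‖ ^ 2 := by
  classical
  have h1 : ∑ i ∈ s, ∑ j ∈ s, ‖v i - v j‖ ^ 2
      = 2 * s.card * ∑ i ∈ s, ‖v i‖ ^ 2 - 2 * ‖∑ i ∈ s, v i‖ ^ 2 := by
    have h2 : ‖∑ i ∈ s, v i‖ ^ 2 = ∑ i ∈ s, ∑ j ∈ s, inner ℝ (v i) (v j) := by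
      rw [← real_inner_self_eq_norm_sq, sum_inner]
      simp_rw [inner_sum]
    simp_rw [h2, norm_sub_sq_real, Finset.sum_add_distrib, Finset.sum_sub_distrib,
      Finset.sum_const, ← Finset.mul_sum, nsmul_eq_mul, ← Finset.mul_sum]
    ring
  have h3 : ∑ i ∈ s, ∑ j ∈ s, (if i = j then 0 else m) ≤ ∑ i ∈ s, ∑ j ∈ s, ‖v i - v j‖ ^ 2 := by
    refine Finset.sum_le_sum fun i hi => Finset.sum_le_sum fun j hj => ?_
    split_ifs with hij
    · positivity
    · exact h i hi j hj hij
  have h4 : ∑ i ∈ s, ∑ j ∈ s, (if i = j then 0 else m) = (s.card : ℝ) * (s.card - 1) * m := by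
    have h5 : ∀ i ∈ s, ∑ j ∈ s, (if i = j then 0 else m) = (s.card - 1) * m := by
      intro i hi
      have : ∀ j, (if i = j then 0 else m) = m - if i = j then m else 0 := by
        intro j; split_ifs <;> simp
      simp_rw [this, Finset.sum_sub_distrib, Finset.sum_const, nsmul_eq_mul,
        Finset.sum_ite_eq, if_pos hi]
      ring
    rw [Finset.sum_congr rfl h5, Finset.sum_const, nsmul_eq_mul]
    ring
  nlinarith [sq_nonneg ‖∑ i ∈ s, v i‖]

/-- Blichfeldt's weight replaces disjoint balls by larger overlapping ones. Only the `k` points of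
positive weight count; for them `∑ 2‖vᵢ‖²/m ≥ k - 1`, so the total weight is at most `k - (k - 1)`.
-/
theorem sum_ofReal_one_sub_le_one {ι : Type*} (s : Finset ι) (v : ι → V) {m : ℝ} (hm : 0 < m)
    (h : ∀ i ∈ s, ∀ j ∈ s, i ≠ j → m ≤ ‖v i - v j‖ ^ 2) :
    ∑ i ∈ s, ENNReal.ofReal (1 - 2 * ‖v i‖ ^ 2 / m) ≤ 1 := by
  classical
  set t := s.filter fun i => 0 < 1 - 2 * ‖v i‖ ^ 2 / m with ht
  have h1 : ∑ i ∈ s, ENNReal.ofReal (1 - 2 * ‖v i‖ ^ 2 / m)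
      = ∑ i ∈ t, ENNReal.ofReal (1 - 2 * ‖v i‖ ^ 2 / m) := by
    rw [ht, Finset.sum_filter_of_ne]
    intro i _ hi
    by_contra hn
    exact hi (ENNReal.ofReal_of_nonpos (not_lt.1 hn))
  rw [h1, ← ENNReal.ofReal_sum_of_nonneg fun i hi => (Finset.mem_filter.1 hi).2.le,
    ← ENNReal.ofReal_one]
  apply ENNReal.ofReal_le_ofReal
  have h2 := card_mul_card_sub_one_mul_le t v fun i hi j hj =>
    h i (Finset.mem_filter.1 hi).1 j (Finset.mem_filter.1 hj).1
  rw [Finset.sum_sub_distrib, Finset.sum_const, nsmul_eq_mul, mul_one, ← Finset.sum_div,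
    ← Finset.mul_sum]
  rcases t.eq_empty_or_nonempty with h0 | h0
  · simp [h0]
  have hc : (0 : ℝ) < t.card := by exact_mod_cast h0.card_pos
  have h3 : ((t.card : ℝ) - 1) * m ≤ 2 * ∑ i ∈ t, ‖v i‖ ^ 2 := by
    refine le_of_mul_le_mul_left ?_ hc
    linarith
  have h4 : (t.card : ℝ) - 1 ≤ (2 * ∑ i ∈ t, ‖v i‖ ^ 2) / m := (le_div_iff₀ hm).2 h3
  linarith

variable [FiniteDimensional ℝ V] [MeasurableSpace V] [BorelSpace V]

/-- Unfolding the integral over a fundamental domain sums the weight over `u + L`, whose points are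
`√m`-separated; each such sum is at most `1`. -/
theorem lintegral_ofReal_one_sub_le_covolume (L : Submodule ℤ V) [DiscreteTopology L]
    [IsZLattice ℝ L] {m : ℝ} (hm : 0 < m) (h : ∀ x ∈ L, x ≠ 0 → m ≤ ‖x‖ ^ 2) :
    ∫⁻ u : V, ENNReal.ofReal (1 - 2 * ‖u‖ ^ 2 / m) ≤ ENNReal.ofReal (ZLattice.covolume L) := by
  let b := Module.finBasis ℤ L
  have : VAddInvariantMeasure L V volume :=
    inferInstanceAs (VAddInvariantMeasure L.toAddSubgroup V volume)
  have hD := ZLattice.isAddFundamentalDomain b (volume : Measure V)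
  rw [ZLattice.covolume_eq_measure_fundamentalDomain L volume hD, Measure.real,
    ENNReal.ofReal_toReal, hD.lintegral_eq_tsum'', ← lintegral_tsum]
  · calc _ ≤ ∫⁻ u in ZSpan.fundamentalDomain (b.ofZLatticeBasis ℝ L), 1 := by
          refine lintegral_mono fun u => ?_
          rw [ENNReal.tsum_eq_iSup_sum]
          refine iSup_le fun s => ?_
          refine sum_ofReal_one_sub_le_one s (fun i : L => (i +ᵥ u : V)) hm fun i _ j _ hij => ?_
          have : (i +ᵥ u : V) - (j +ᵥ u) = ((i - j : L) : V) := by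
            change ((i : V) + u) - ((j : V) + u) = _
            simp
          rw [this]
          exact h _ (i - j).2 (by simpa [sub_eq_zero] using hij)
      _ = _ := by simp
  · intro i
    have : Measurable fun u : V => (i +ᵥ u : V) := measurable_const_vadd i
    fun_prop
  · exact (ZSpan.fundamentalDomain_isBounded _).measure_lt_top.ne

theorem setLIntegral_Ioi_ofReal_sqrt_pow {n : ℕ} (hn : n ≠ 0) :
    ∫⁻ t in Set.Ioi (0 : ℝ), ENNReal.ofReal (√(1 - t) ^ n)
      = ENNReal.ofReal (1 / ((n : ℝ) / 2 + 1)) := by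
  have h0 : (∫ t in (0 : ℝ)..1, √(1 - t) ^ n) = 1 / ((n : ℝ) / 2 + 1) := by
    rw [intervalIntegral.integral_comp_sub_left (fun t : ℝ => √t ^ n)]
    have : ∀ t ∈ Set.uIcc (1 - 1 : ℝ) (1 - 0), √t ^ n = t ^ ((n : ℝ) / 2) := by
      intro t ht
      rw [Set.uIcc_of_le (by norm_num)] at ht
      rw [Real.sqrt_eq_rpow, ← Real.rpow_mul_natCast (by linarith [ht.1])]
      ring_nf
    rw [intervalIntegral.integral_congr this, integral_rpow (Or.inl (by
      have : (0 : ℝ) ≤ (n : ℝ) / 2 := by positivity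
      linarith))]
    have : (n : ℝ) / 2 + 1 ≠ 0 := by positivity
    simp [Real.zero_rpow this]
  rw [← Set.Ioc_union_Ioi_eq_Ioi (zero_le_one (α := ℝ)),
    lintegral_union measurableSet_Ioi (Set.Ioc_disjoint_Ioi le_rfl),
    setLIntegral_congr_fun (g := fun _ => 0) measurableSet_Ioi, lintegral_zero, add_zero,
    ← ofReal_integral_eq_lintegral_ofReal,
    ← intervalIntegral.integral_of_le zero_le_one, h0]
  · refine (Continuous.integrableOn_Icc (by fun_prop)).mono_set Set.Ioc_subset_Icc_self
  · exact Filter.Eventually.of_forall fun t => by positivity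
  · intro t ht
    -- The square root of a negative number is `0`; this matches the empty superlevel sets for `t >
    -- 1`.
    have : √(1 - t) = 0 := Real.sqrt_eq_zero_of_nonpos (by linarith [Set.mem_Ioi.1 ht])
    simp [this, hn]

/-- Layer cake: the superlevel set at `0 < t ≤ 1` is a ball of radius `√(m/2) √(1 - t)`. Integrating
over `t` contributes `1 / (n/2 + 1)`, which turns `Γ(n/2 + 1)` into `Γ(n/2 + 2)`. -/
theorem lintegral_ofReal_one_sub [Nontrivial V] {m : ℝ} (hm : 0 < m) :
    ∫⁻ u : V, ENNReal.ofReal (1 - 2 * ‖u‖ ^ 2 / m)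
      = ENNReal.ofReal (√m ^ finrank ℝ V *
        (√(Real.pi / 2) ^ finrank ℝ V / Real.Gamma (finrank ℝ V / 2 + 2))) := by
  set n := finrank ℝ V with hn
  have hn0 : n ≠ 0 := finrank_pos.ne'
  have h1 : ∀ u : V, ENNReal.ofReal (1 - 2 * ‖u‖ ^ 2 / m)
      = ENNReal.ofReal (max 0 (1 - 2 * ‖u‖ ^ 2 / m)) := by
    intro u
    rcases le_total 0 (1 - 2 * ‖u‖ ^ 2 / m) with h | h
    · rw [max_eq_right h]
    · rw [max_eq_left h, ENNReal.ofReal_of_nonpos h, ENNReal.ofReal_zero]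
  simp_rw [h1]
  rw [lintegral_eq_lintegral_meas_le volume (Filter.Eventually.of_forall fun u => by simp)
    (by fun_prop)]
  have h2 : ∀ t ∈ Set.Ioi (0 : ℝ), volume {u : V | t ≤ max 0 (1 - 2 * ‖u‖ ^ 2 / m)}
      = ENNReal.ofReal (√(m / 2) ^ n * (√Real.pi ^ n / Real.Gamma (n / 2 + 1)))
        * ENNReal.ofReal (√(1 - t) ^ n) := by
    intro t ht
    have ht : 0 < t := ht
    rcases le_or_gt t 1 with ht1 | ht1
    · have : {u : V | t ≤ max 0 (1 - 2 * ‖u‖ ^ 2 / m)}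
          = Metric.closedBall 0 (√(m / 2) * √(1 - t)) := by
        ext u
        rw [Set.mem_ofPred_eq, mem_closedBall_zero_iff, ← Real.sqrt_mul (by positivity),
          Real.le_sqrt (norm_nonneg _) (mul_nonneg (by positivity) (by linarith)), le_max_iff,
          or_iff_right (not_le.2 ht), le_sub_comm, div_le_iff₀ hm]
        constructor <;> intro h <;> linarith
      rw [this, InnerProductSpace.volume_closedBall, ← hn,
        ← ENNReal.ofReal_pow (by positivity), ← ENNReal.ofReal_mul (by positivity),
        ← ENNReal.ofReal_mul (by positivity)]
      congr 1
      ring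
    · have h3 : {u : V | t ≤ max 0 (1 - 2 * ‖u‖ ^ 2 / m)} = ∅ := by
        ext u
        have : 0 ≤ 2 * ‖u‖ ^ 2 / m := by positivity
        simp only [Set.mem_ofPred_eq, Set.mem_empty_iff_false, iff_false, not_le, max_lt_iff]
        exact ⟨ht, by linarith⟩
      have : √(1 - t) = 0 := Real.sqrt_eq_zero_of_nonpos (by linarith)
      rw [h3, this]
      simp [hn0]
  rw [setLIntegral_congr_fun measurableSet_Ioi h2, lintegral_const_mul _ (by fun_prop),
    setLIntegral_Ioi_ofReal_sqrt_pow hn0, ← ENNReal.ofReal_mul (by positivity)]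
  congr 1
  have h4 : Real.Gamma ((n : ℝ) / 2 + 2) = (n / 2 + 1) * Real.Gamma (n / 2 + 1) := by
    rw [← Real.Gamma_add_one (by positivity)]
    ring_nf
  have h5 : Real.Gamma ((n : ℝ) / 2 + 1) ≠ 0 := (Real.Gamma_pos_of_pos (by positivity)).ne'
  rw [h4, Real.sqrt_div hm.le, Real.sqrt_div Real.pi_pos.le, div_pow, div_pow]
  field_simp

/-- **Blichfeldt's bound**. -/
theorem pow_mul_le_covolume [Nontrivial V] (L : Submodule ℤ V) [DiscreteTopology L]
    [IsZLattice ℝ L] {m : ℝ} (hm : 0 < m) (h : ∀ x ∈ L, x ≠ 0 → m ≤ ‖x‖ ^ 2) :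
    √m ^ finrank ℝ V * (√(Real.pi / 2) ^ finrank ℝ V / Real.Gamma (finrank ℝ V / 2 + 2))
      ≤ ZLattice.covolume L := by
  have := lintegral_ofReal_one_sub_le_covolume L hm h
  rw [lintegral_ofReal_one_sub hm] at this
  exact (ENNReal.ofReal_le_ofReal_iff (ZLattice.covolume_pos L _).le).1 this

end Blichfeldt

/-! ### Gram determinants, the trace inequality and the numerical bound. -/

theorem covolume_sq_eq_det_gram {V : Type*} [NormedAddCommGroup V] [InnerProductSpace ℝ V]
    [FiniteDimensional ℝ V] [MeasurableSpace V] [BorelSpace V] {r : ℕ} (b : Basis (Fin r) ℝ V) :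
    ZLattice.covolume (Submodule.span ℤ (Set.range b)) ^ 2 = (Matrix.gram ℝ b).det := by
  have hr : finrank ℝ V = r := by simp [finrank_eq_card_basis b]
  let o : OrthonormalBasis (Fin r) ℝ V := (stdOrthonormalBasis ℝ V).reindex (finCongr hr)
  have ho : volume (ZSpan.fundamentalDomain o.toBasis) = 1 := by
    rw [measure_congr (ZSpan.fundamentalDomain_ae_parallelepiped o.toBasis volume)]
    simpa using o.volume_parallelepiped
  rw [ZLattice.covolume_eq_measure_fundamentalDomain _ volume (ZSpan.isAddFundamentalDomain b _),
    ZSpan.measureReal_fundamentalDomain b volume o.toBasis, Measure.real, ho,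
    Matrix.gram_eq_conjTranspose_mul o b, Matrix.det_mul, Matrix.det_conjTranspose]
  simp [Basis.det_apply, sq]
  rfl

/-- Blichfeldt's bound, squared, for the full lattice generated by `x` in its real span. -/
theorem pow_mul_le_det_gram {E : Type*} [NormedAddCommGroup E] [InnerProductSpace ℝ E]
    {r : ℕ} (hr : r ≠ 0) {x : Fin r → E} (hx : LinearIndependent ℝ x) {m : ℝ} (hm : 0 < m)
    (h : ∀ y ∈ Submodule.span ℤ (Set.range x), y ≠ 0 → m ≤ ‖y‖ ^ 2) :
    m ^ r * ((Real.pi / 2) ^ r / Real.Gamma (r / 2 + 2) ^ 2) ≤ (Matrix.gram ℝ x).det := by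
  let W := Submodule.span ℝ (Set.range x)
  let b : Basis (Fin r) ℝ W := Basis.span hx
  let : MeasurableSpace W := borel W
  have : BorelSpace W := ⟨rfl⟩
  have hf : finrank ℝ W = r := by simp [finrank_eq_card_basis b]
  have : FiniteDimensional ℝ W := b.finiteDimensional_of_finite
  have : Nontrivial W := nontrivial_of_finrank_pos (R := ℝ) (by omega)
  have hb : ∀ i, (b i : E) = x i := fun i => congrArg Subtype.val (Basis.span_apply hx i)
  have hg : Matrix.gram ℝ x = Matrix.gram ℝ b := by
    ext i j
    simp [Matrix.gram_apply, ← hb]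
  rw [hg, ← covolume_sq_eq_det_gram b]
  have key := pow_mul_le_covolume (Submodule.span ℤ (Set.range b)) hm (fun y hy hy0 => by
    have := h y (by
      have h1 := Submodule.mem_map_of_mem (f := (W.subtype).restrictScalars ℤ) hy
      rw [Submodule.map_span, ← Set.range_comp] at h1
      have h2 : (W.subtype.restrictScalars ℤ : W → E) ∘ b = x := funext hb
      rwa [h2] at h1) (by simpa using hy0)
    simpa using this)
  rw [hf] at key
  have h0 : 0 ≤ √m ^ r * (√(Real.pi / 2) ^ r / Real.Gamma (r / 2 + 2)) := by
    have := Real.Gamma_pos_of_pos (s := (r : ℝ) / 2 + 2) (by positivity)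
    positivity
  refine le_trans (le_of_eq ?_) (pow_le_pow_left₀ h0 key 2)
  have h1 : ∀ a : ℝ, 0 ≤ a → (√a ^ r) ^ 2 = a ^ r := fun a ha => by
    rw [← pow_mul, mul_comm, pow_mul, Real.sq_sqrt ha]
  rw [mul_pow, div_pow _ (Real.Gamma _), h1 _ hm.le, h1 _ (by positivity)]

theorem card_pow_mul_prod_le_sum_pow {ι : Type*} [Fintype ι] [Nonempty ι] {z : ι → ℝ}
    (hz : ∀ i, 0 ≤ z i) :
    (Fintype.card ι : ℝ) ^ Fintype.card ι * ∏ i, z i ≤ (∑ i, z i) ^ Fintype.card ι := by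
  have hc : (0 : ℝ) < Fintype.card ι := by exact_mod_cast Fintype.card_pos
  have h := Real.geom_mean_le_arith_mean Finset.univ (fun _ => (1 : ℝ)) z (by simp)
    (by simpa using hc) fun i _ => hz i
  simp only [Real.rpow_one, Finset.sum_const, Finset.card_univ, nsmul_eq_mul, mul_one,
    one_mul] at h
  have h2 := pow_le_pow_left₀ (Real.rpow_nonneg (Finset.prod_nonneg fun i _ => hz i) _) h
    (Fintype.card ι)
  rw [Real.rpow_inv_natCast_pow (Finset.prod_nonneg fun i _ => hz i) Fintype.card_ne_zero,
    div_pow, le_div_iff₀ (by positivity)] at h2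
  linarith

open scoped MatrixOrder in
-- With `A = SᵗS`, the matrix `S B Sᵗ` is positive semidefinite, with trace `tr(AB)` and determinant
-- `det A det B`; AM-GM applies to its eigenvalues.
theorem card_pow_mul_det_mul_det_le_trace_pow {ι : Type*} [Fintype ι] [DecidableEq ι]
    [Nonempty ι] {A B : Matrix ι ι ℝ} (hA : A.PosSemidef) (hB : B.PosSemidef) :
    (Fintype.card ι : ℝ) ^ Fintype.card ι * (A.det * B.det)
      ≤ (A * B).trace ^ Fintype.card ι := by
  obtain ⟨S, rfl⟩ := CStarAlgebra.nonneg_iff_eq_star_mul_self.1 hA.nonneg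
  have hC : (S * B * S.conjTranspose).PosSemidef := hB.mul_mul_conjTranspose_same S
  have h := card_pow_mul_prod_le_sum_pow hC.eigenvalues_nonneg
  have h1 := hC.1.det_eq_prod_eigenvalues
  have h2 := hC.1.trace_eq_sum_eigenvalues
  simp only [RCLike.ofReal_real_eq_id, id] at h1 h2
  rw [← h1, ← h2, Matrix.det_mul, Matrix.det_mul] at h
  have h3 : (S * B * S.conjTranspose).trace = (star S * S * B).trace := by
    rw [Matrix.trace_mul_comm, ← Matrix.mul_assoc]
    rfl
  rw [h3] at h
  convert h using 2
  rw [Matrix.det_mul, Matrix.star_eq_conjTranspose]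
  ring

theorem Gamma_nat_add_half_add_two (k : ℕ) :
    Real.Gamma ((2 * k + 1 : ℕ) / 2 + 2)
      = (∏ i ∈ Finset.range (k + 2), ((i : ℝ) + 1 / 2)) * √Real.pi := by
  have h : ∀ n : ℕ, Real.Gamma (n + 1 / 2)
      = (∏ i ∈ Finset.range n, ((i : ℝ) + 1 / 2)) * √Real.pi := by
    intro n
    induction n with
    | zero => simpa using Real.Gamma_one_half_eq
    | succ n ih =>
      have : ((n + 1 : ℕ) : ℝ) + 1 / 2 = (n + 1 / 2) + 1 := by push_cast; ring
      rw [this, Real.Gamma_add_one (by positivity), ih, Finset.prod_range_succ]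
      ring
  rw [← h]
  push_cast
  ring_nf

/-- Source of the constant `43`: the inequality says that Blichfeldt's bound for the Hermite
constant of rank `r` is less than `√r`. It fails at `r = 1` and at `r = 44`. -/
theorem one_lt_pow_mul_blichfeldt {r : ℕ} (h2 : 2 ≤ r) (h43 : r ≤ 43) :
    1 < (r : ℝ) ^ r * ((Real.pi / 2) ^ r / Real.Gamma (r / 2 + 2) ^ 2) ^ 2 := by
  have hG : 0 < Real.Gamma ((r : ℝ) / 2 + 2) := Real.Gamma_pos_of_pos (by positivity)
  rw [div_pow, ← mul_div_assoc, one_lt_div (by positivity)]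
  have hpi := Real.pi_gt_d4
  obtain ⟨k, rfl | rfl⟩ := r.even_or_odd'
  · have h1 : Real.Gamma ((2 * k : ℕ) / 2 + 2) = (k + 1).factorial := by
      rw [← Real.Gamma_nat_eq_factorial]
      push_cast
      ring_nf
    rw [h1]
    have h3 : (((3.1415 : ℝ) / 2) ^ (2 * k)) ^ 2 ≤ ((Real.pi / 2) ^ (2 * k)) ^ 2 := by gcongr
    refine lt_of_lt_of_le ?_ (mul_le_mul_of_nonneg_left h3 (by positivity))
    have hk1 : 1 ≤ k := by omega
    have hk2 : k ≤ 21 := by omega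
    clear h1 h3 hG h2 h43
    interval_cases k <;> norm_num [Nat.factorial]
  · rw [Gamma_nat_add_half_add_two]
    -- The half-integral Gamma value carries `√π`, so its fourth power carries `π²`. The same factor
    -- is split off the other side, leaving rational numbers once `π` is replaced by `3.1415`.
    have h3 : (((3.1415 : ℝ) / 2) ^ (2 * k)) ^ 2 / 4 ≤ ((Real.pi / 2) ^ (2 * k)) ^ 2 / 4 := by
      gcongr
    have h4 : ((Real.pi / 2) ^ (2 * k + 1)) ^ 2
        = ((Real.pi / 2) ^ (2 * k)) ^ 2 / 4 * Real.pi ^ 2 := by ring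
    have h5 : (((∏ i ∈ Finset.range (k + 2), ((i : ℝ) + 1 / 2)) * √Real.pi) ^ 2) ^ 2
        = ((∏ i ∈ Finset.range (k + 2), ((i : ℝ) + 1 / 2)) ^ 2) ^ 2 * Real.pi ^ 2 := by
      rw [mul_pow, Real.sq_sqrt Real.pi_pos.le, mul_pow]
    rw [h4, h5, ← mul_assoc]
    refine mul_lt_mul_of_pos_right ?_ (by positivity)
    refine lt_of_lt_of_le ?_ (mul_le_mul_of_nonneg_left h3 (by positivity))
    have hk1 : 1 ≤ k := by omega
    have hk2 : k ≤ 21 := by omega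
    clear h3 h4 h5 hG h2 h43
    interval_cases k <;> norm_num [Finset.prod_range_succ]

/-- Sums of `r` split tensors whose factors are linearly independent are long. -/
theorem mul_lt_norm_sum_tmul_sq {E F : Type*} [NormedAddCommGroup E] [InnerProductSpace ℝ E]
    [NormedAddCommGroup F] [InnerProductSpace ℝ F] {r : ℕ} (h2 : 2 ≤ r) (h43 : r ≤ 43)
    {x : Fin r → E} {y : Fin r → F} (hx : LinearIndependent ℝ x) (hy : LinearIndependent ℝ y)
    {a b : ℝ} (ha : 0 < a) (hb : 0 < b)
    (hxa : ∀ v ∈ Submodule.span ℤ (Set.range x), v ≠ 0 → a ≤ ‖v‖ ^ 2)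
    (hyb : ∀ v ∈ Submodule.span ℤ (Set.range y), v ≠ 0 → b ≤ ‖v‖ ^ 2) :
    a * b < ‖∑ i, x i ⊗ₜ[ℝ] y i‖ ^ 2 := by
  have : Nonempty (Fin r) := ⟨⟨0, by omega⟩⟩
  have hA := pow_mul_le_det_gram (by omega) hx ha hxa
  have hB := pow_mul_le_det_gram (by omega) hy hb hyb
  set K := (Real.pi / 2) ^ r / Real.Gamma (r / 2 + 2) ^ 2
  have hK : 0 < K := by
    have := Real.Gamma_pos_of_pos (s := (r : ℝ) / 2 + 2) (by positivity)
    positivity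
  have hT := card_pow_mul_det_mul_det_le_trace_pow (Matrix.posSemidef_gram ℝ x)
    (Matrix.posSemidef_gram ℝ y)
  have htr : (Matrix.gram ℝ x * Matrix.gram ℝ y).trace = ‖∑ i, x i ⊗ₜ[ℝ] y i‖ ^ 2 := by
    rw [← real_inner_self_eq_norm_sq, sum_inner, Matrix.trace]
    refine Finset.sum_congr rfl fun i _ => ?_
    rw [inner_sum, Matrix.diag_apply, Matrix.mul_apply]
    refine Finset.sum_congr rfl fun j _ => ?_
    rw [inner_tmul, Matrix.gram_apply, Matrix.gram_apply, real_inner_comm (y j)]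
  rw [htr, Fintype.card_fin] at hT
  refine lt_of_pow_lt_pow_left₀ r (by positivity) (lt_of_lt_of_le ?_ hT)
  calc (a * b) ^ r < (a * b) ^ r * ((r : ℝ) ^ r * K ^ 2) :=
        lt_mul_of_one_lt_right (by positivity) (one_lt_pow_mul_blichfeldt h2 h43)
    _ = (r : ℝ) ^ r * ((a ^ r * K) * (b ^ r * K)) := by ring
    _ ≤ _ := mul_le_mul_of_nonneg_left
        (mul_le_mul hA hB (by positivity) (le_trans (by positivity) hA)) (by positivity)

/-! ### Minimal vectors and gaps between norms in discrete lattices. -/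

section Minimum

variable {E : Type*} [NormedAddCommGroup E] [InnerProductSpace ℝ E] [FiniteDimensional ℝ E]

theorem finite_setOf_mem_norm_le (L : Submodule ℤ E) [DiscreteTopology L] (R : ℝ) :
    {x | x ∈ L ∧ ‖x‖ ≤ R}.Finite := by
  have : DiscreteTopology L.toAddSubgroup := ‹DiscreteTopology L›
  have := Metric.finite_isBounded_inter_isClosed (s := (L.toAddSubgroup : Set E))
    (K := Metric.closedBall (0 : E) R)
    DiscreteTopology.isDiscrete Metric.isBounded_closedBall
    (AddSubgroup.isClosed_of_discrete (H := L.toAddSubgroup))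
  refine this.subset fun x hx => ?_
  exact ⟨by simpa using hx.2, hx.1⟩

theorem exists_minimal (L : Submodule ℤ E) [DiscreteTopology L] (hL : L ≠ ⊥) :
    ∃ x ∈ L, x ≠ 0 ∧ ∀ y ∈ L, y ≠ 0 → ‖x‖ ≤ ‖y‖ := by
  obtain ⟨v, hv, hv0⟩ := (Submodule.ne_bot_iff L).1 hL
  obtain ⟨x, hx, hmin⟩ := Set.exists_min_image ({x | x ∈ L ∧ ‖x‖ ≤ ‖v‖} \ {0}) norm
    ((finite_setOf_mem_norm_le L ‖v‖).subset Set.sdiff_subset) ⟨v, ⟨hv, le_rfl⟩, hv0⟩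
  refine ⟨x, hx.1.1, hx.2, fun y hy hy0 => ?_⟩
  rcases le_total ‖y‖ ‖v‖ with h | h
  · exact hmin y ⟨⟨hy, h⟩, hy0⟩
  · exact hx.1.2.trans h

theorem exists_norm_gap (L : Submodule ℤ E) [DiscreteTopology L] (R : ℝ) :
    ∃ S, R < S ∧ ∀ y ∈ L, R < ‖y‖ → S ≤ ‖y‖ := by
  rcases ({y | y ∈ L ∧ ‖y‖ ≤ R + 1} ∩ {y | R < ‖y‖}).eq_empty_or_nonempty with h | h
  · refine ⟨R + 1, by linarith, fun y hy hR => ?_⟩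
    by_contra hn
    exact (Set.eq_empty_iff_forall_notMem.1 h y) ⟨⟨hy, (not_le.1 hn).le⟩, hR⟩
  · obtain ⟨x, hx, hmin⟩ := Set.exists_min_image _ norm
      ((finite_setOf_mem_norm_le L (R + 1)).subset Set.inter_subset_left) h
    refine ⟨‖x‖, hx.2, fun y hy hR => ?_⟩
    rcases le_total ‖y‖ (R + 1) with h' | h'
    · exact hmin y ⟨⟨hy, h'⟩, hR⟩
    · exact hx.1.2.trans h'

end Minimum

/-! ### Sums of split tensors and Kitaoka's theorem. -/

section Split

variable {E F : Type*} [NormedAddCommGroup E] [InnerProductSpace ℝ E]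
  [NormedAddCommGroup F] [InnerProductSpace ℝ F]

/-- `z` is a sum of `r` split tensors with factors in `L` and `M`. -/
def IsSumTmul (L : Submodule ℤ E) (M : Submodule ℤ F) (r : ℕ) (z : E ⊗[ℝ] F) : Prop :=
  ∃ (x : Fin r → E) (y : Fin r → F), (∀ i, x i ∈ L) ∧ (∀ i, y i ∈ M) ∧
    z = ∑ i, x i ⊗ₜ[ℝ] y i

theorem IsSumTmul.add {L : Submodule ℤ E} {M : Submodule ℤ F} {r s : ℕ} {z w : E ⊗[ℝ] F}
    (hz : IsSumTmul L M r z) (hw : IsSumTmul L M s w) : IsSumTmul L M (r + s) (z + w) := by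
  obtain ⟨x, y, hx, hy, rfl⟩ := hz
  obtain ⟨x', y', hx', hy', rfl⟩ := hw
  refine ⟨Fin.append x x', Fin.append y y', fun i => ?_, fun i => ?_, ?_⟩
  · refine Fin.addCases (fun j => ?_) (fun j => ?_) i <;> simp [hx, hx']
  · refine Fin.addCases (fun j => ?_) (fun j => ?_) i <;> simp [hy, hy']
  · simp [Fin.sum_univ_add]

theorem exists_isSumTmul {L : Submodule ℤ E} {M : Submodule ℤ F} {z : E ⊗[ℝ] F}
    (hz : z ∈ tensorLattice L M) : ∃ r, IsSumTmul L M r z := by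
  obtain ⟨t, rfl⟩ := hz
  induction t using TensorProduct.induction_on with
  | zero => exact ⟨0, Fin.elim0, Fin.elim0, fun i => i.elim0, fun i => i.elim0, by simp⟩
  | tmul x y => exact ⟨1, fun _ => x, fun _ => y, fun _ => x.2, fun _ => y.2, by simp⟩
  | add s t hs ht =>
    obtain ⟨r, hr⟩ := hs
    obtain ⟨r', hr'⟩ := ht
    exact ⟨r + r', by rw [map_add]; exact hr.add hr'⟩

theorem IsSumTmul.comm {L : Submodule ℤ E} {M : Submodule ℤ F} {r : ℕ} {z : E ⊗[ℝ] F}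
    (hz : IsSumTmul L M r z) : IsSumTmul M L r (TensorProduct.comm ℝ E F z) := by
  obtain ⟨x, y, hx, hy, rfl⟩ := hz
  exact ⟨y, x, hy, hx, by simp⟩

/-- By discreteness, the `ℤ`-rank of the span of the `xᵢ` is its real dimension, so a real
dependence makes it less than `r`. Expanding the `xᵢ` on a `ℤ`-basis and regrouping gives fewer
terms, still with factors in `L` and `M`. -/
theorem exists_lt_isSumTmul_of_not_linearIndependent [FiniteDimensional ℝ E]
    {L : Submodule ℤ E} [DiscreteTopology L] {M : Submodule ℤ F} {r : ℕ} {x : Fin r → E}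
    {y : Fin r → F} (hx : ∀ i, x i ∈ L) (hy : ∀ i, y i ∈ M)
    (h : ¬ LinearIndependent ℝ x) : ∃ s < r, IsSumTmul L M s (∑ i, x i ⊗ₜ[ℝ] y i) := by
  set N := Submodule.span ℤ (Set.range x) with hN
  have hNL : N ≤ L := Submodule.span_le.2 (by rintro _ ⟨i, rfl⟩; exact hx i)
  have hd : DiscreteTopology N := DiscreteTopology.of_subset ‹DiscreteTopology L› hNL
  have hr : finrank ℤ N < r := by
    have h1 : Set.finrank ℝ (Set.range x) = finrank ℤ N :=
      Real.finrank_eq_int_finrank_of_discrete hd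
    have h2 := finrank_range_le_card (R := ℝ) x
    rw [Fintype.card_fin, h1] at h2
    refine lt_of_le_of_ne h2 fun h3 => h ?_
    rw [linearIndependent_iff_card_eq_finrank_span, Fintype.card_fin, h1, h3]
  let b := Module.finBasis ℤ N
  let c : Fin r → Fin (finrank ℤ N) → ℤ := fun i => b.repr ⟨x i, Submodule.subset_span ⟨i, rfl⟩⟩
  refine ⟨_, hr, fun j => b j, fun j => ∑ i, c i j • y i, fun j => hNL (b j).2,
    fun j => Submodule.sum_mem _ fun i _ => M.smul_mem _ (hy i), ?_⟩
  have hxc : ∀ i, x i = ∑ j, c i j • (b j : E) := fun i => by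
    have := congrArg Subtype.val (b.sum_repr ⟨x i, Submodule.subset_span ⟨i, rfl⟩⟩)
    simpa only [AddSubmonoidClass.coe_finsetSum, SetLike.val_smul] using this.symm
  conv_lhs => enter [2, i]; rw [hxc i]
  simp_rw [TensorProduct.sum_tmul, TensorProduct.tmul_sum, ← Int.cast_smul_eq_zsmul ℝ,
    TensorProduct.smul_tmul]
  exact Finset.sum_comm

variable [FiniteDimensional ℝ E] [FiniteDimensional ℝ F]
  (L : Submodule ℤ E) [DiscreteTopology L] [IsZLattice ℝ L]
  (M : Submodule ℤ F) [DiscreteTopology M] [IsZLattice ℝ M]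

/-- **Kitaoka's theorem**: minimal vectors of a tensor product with a factor of rank at most `43`
are split. -/
theorem exists_eq_tmul_of_mem_minimalVectors (h : finrank ℤ L ≤ 43 ∨ finrank ℤ M ≤ 43)
    {z : tensorLattice L M} (hz : z ∈ minimalVectors (tensorLattice L M)) :
    ∃ x ∈ L, ∃ y ∈ M, (z : E ⊗[ℝ] F) = x ⊗ₜ[ℝ] y := by
  classical
  -- A shortest decomposition has both families of factors independent.
  obtain ⟨r, ⟨x, y, hx, hy, hzxy⟩, hmin⟩ :
      ∃ r, IsSumTmul L M r z ∧ ∀ s < r, ¬ IsSumTmul L M s (z : E ⊗[ℝ] F) :=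
    have hex := exists_isSumTmul z.2
    ⟨Nat.find hex, Nat.find_spec hex, fun s hs => Nat.find_min hex hs⟩
  have hxi : LinearIndependent ℝ x := by
    by_contra hn
    obtain ⟨s, hs, hs'⟩ := exists_lt_isSumTmul_of_not_linearIndependent hx hy hn
    exact hmin s hs (hzxy ▸ hs')
  have hyi : LinearIndependent ℝ y := by
    by_contra hn
    obtain ⟨s, hs, hs'⟩ := exists_lt_isSumTmul_of_not_linearIndependent hy hx hn
    refine hmin s hs ?_
    have := hs'.comm
    rw [map_sum] at this
    simpa [hzxy] using this
  have hz0 : (z : E ⊗[ℝ] F) ≠ 0 := by simpa using hz.1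
  match r with
  | 0 => simp [hzxy] at hz0
  | 1 => exact ⟨x 0, hx 0, y 0, hy 0, by simpa using hzxy⟩
  | r + 2 =>
    have h43 : r + 2 ≤ 43 := by
      have h1 := hxi.fintype_card_le_finrank
      have h2 := hyi.fintype_card_le_finrank
      rw [Fintype.card_fin, ← ZLattice.rank ℝ L] at h1
      rw [Fintype.card_fin, ← ZLattice.rank ℝ M] at h2
      omega
    obtain ⟨x₀, hx₀, hx₀', hxm⟩ := exists_minimal L
      ((Submodule.ne_bot_iff L).2 ⟨x 0, hx 0, hxi.ne_zero 0⟩)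
    obtain ⟨y₀, hy₀, hy₀', hym⟩ := exists_minimal M
      ((Submodule.ne_bot_iff M).2 ⟨y 0, hy 0, hyi.ne_zero 0⟩)
    have hxL : Submodule.span ℤ (Set.range x) ≤ L :=
      Submodule.span_le.2 (by rintro _ ⟨i, rfl⟩; exact hx i)
    have hyM : Submodule.span ℤ (Set.range y) ≤ M :=
      Submodule.span_le.2 (by rintro _ ⟨i, rfl⟩; exact hy i)
    have hlt := mul_lt_norm_sum_tmul_sq (by omega) h43 hxi hyi
      (pow_pos (norm_pos_iff.2 hx₀') 2) (pow_pos (norm_pos_iff.2 hy₀') 2)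
      (fun v hv hv0 => pow_le_pow_left₀ (norm_nonneg _) (hxm v (hxL hv) hv0) 2)
      (fun v hv hv0 => pow_le_pow_left₀ (norm_nonneg _) (hym v (hyM hv) hv0) 2)
    rw [← hzxy, ← mul_pow, ← norm_tmul (𝕜 := ℝ) x₀ y₀] at hlt
    have h0 : x₀ ⊗ₜ[ℝ] y₀ ≠ 0 := by
      rw [← norm_ne_zero_iff, norm_tmul]
      simp [hx₀', hy₀']
    have hle := hz.2 ⟨x₀ ⊗ₜ[ℝ] y₀, ⟨⟨x₀, hx₀⟩ ⊗ₜ[ℤ] ⟨y₀, hy₀⟩, rfl⟩⟩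
      fun h => h0 (congrArg Subtype.val h)
    have hle' : ‖(z : E ⊗[ℝ] F)‖ ≤ ‖x₀ ⊗ₜ[ℝ] y₀‖ := hle
    exact absurd hlt (not_lt.2 (pow_le_pow_left₀ (norm_nonneg _) hle' 2))

end Split

/-! ### Failure of perfection. -/

section Perfection

/-- Symmetric matrices are determined by entries indexed by `Sym2 ι`; the relation makes the entry
at `s(p, q)` redundant. -/
theorem finrank_lt_card_sym2 {ι : Type*} [Fintype ι] [DecidableEq ι]
    (S : Submodule ℝ (Matrix ι ι ℝ)) {p q p' q' : ι} (hpq : s(p, q) ≠ s(p', q'))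
    (hsymm : ∀ A ∈ S, ∀ i j, A i j = A j i) (h : ∀ A ∈ S, A p q = A p' q') :
    finrank ℝ S < Fintype.card ι * (Fintype.card ι + 1) / 2 := by
  let f : S →ₗ[ℝ] ({s : Sym2 ι // s ≠ s(p, q)} → ℝ) :=
    { toFun := fun A s => A.1 (Quot.out s.1).1 (Quot.out s.1).2
      map_add' := fun _ _ => rfl
      map_smul' := fun _ _ => rfl }
  have key : ∀ A : S, f A = 0 → ∀ i j, s(i, j) ≠ s(p, q) → A.1 i j = 0 := by
    intro A hA i j hij
    have h1 : A.1 (Quot.out s(i, j)).1 (Quot.out s(i, j)).2 = 0 := congrFun hA ⟨s(i, j), hij⟩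
    have h2 : s((Quot.out s(i, j)).1, (Quot.out s(i, j)).2) = s(i, j) := Quot.out_eq s(i, j)
    rcases Sym2.eq_iff.1 h2 with ⟨h3, h4⟩ | ⟨h3, h4⟩
    · rwa [h3, h4] at h1
    · rw [h3, h4] at h1
      rw [hsymm _ A.2, h1]
  have hf : Function.Injective f := by
    rw [injective_iff_map_eq_zero]
    intro A hA
    have hp : A.1 p q = 0 := by
      rw [h _ A.2]
      exact key A hA _ _ hpq.symm
    ext i j
    by_cases hij : s(i, j) = s(p, q)
    · rcases Sym2.eq_iff.1 hij with ⟨rfl, rfl⟩ | ⟨rfl, rfl⟩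
      · exact hp
      · rw [hsymm _ A.2]
        exact hp
    · exact key A hA i j hij
  have h1 := LinearMap.finrank_le_finrank_of_injective hf
  have h2 : Fintype.card {s : Sym2 ι // s ≠ s(p, q)} < Fintype.card (Sym2 ι) :=
    Fintype.card_subtype_lt (x := s(p, q)) (by simp)
  rw [finrank_fintype_fun_eq_card] at h1
  rw [Sym2.card, Nat.choose_two_right, Nat.add_sub_cancel, mul_comm] at h2
  exact h1.trans_lt h2

variable {E F : Type*} [NormedAddCommGroup E] [InnerProductSpace ℝ E]
  [NormedAddCommGroup F] [InnerProductSpace ℝ F] [FiniteDimensional ℝ E] [FiniteDimensional ℝ F]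
  (L : Submodule ℤ E) [DiscreteTopology L] [IsZLattice ℝ L]
  (M : Submodule ℤ F) [DiscreteTopology M] [IsZLattice ℝ M]

theorem exists_basis_tensorLattice {ι κ : Type*} [Fintype ι] [Fintype κ] (b : Basis ι ℤ L)
    (c : Basis κ ℤ M) : ∃ B : Basis (ι × κ) ℤ (tensorLattice L M),
      ∀ z : tensorLattice L M, ∀ x y, (z : E ⊗[ℝ] F) = x ⊗ₜ[ℝ] y → ∀ p, coordVec B z p
        = (b.ofZLatticeBasis ℝ L).repr x p.1 * (c.ofZLatticeBasis ℝ M).repr y p.2 := by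
  let B₀ := (b.ofZLatticeBasis ℝ L).tensorProduct (c.ofZLatticeBasis ℝ M)
  refine ⟨(B₀.restrictScalars ℤ).map (LinearEquiv.ofEq _ _ (tensorLattice_eq_span L M b c).symm),
    fun z x y hz p => ?_⟩
  have := B₀.restrictScalars_repr_apply ℤ
    (LinearEquiv.ofEq _ _ (tensorLattice_eq_span L M b c) z) p
  rw [LinearEquiv.coe_ofEq_apply, hz, Basis.tensorProduct_repr_tmul_apply] at this
  exact this.trans (mul_comm _ _)

/-- For coordinates `Xᵢ Yⱼ`, both entries being compared equal `X_{i₀} X_{i₁} Y_{j₀} Y_{j₁}`. Both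
ranks being at least `2` makes the two positions distinct. -/
theorem not_isPerfect_tensorLattice (hL : 2 ≤ finrank ℤ L) (hM : 2 ≤ finrank ℤ M)
    (hsplit : ∀ z ∈ minimalVectors (tensorLattice L M), ∃ x y, (z : E ⊗[ℝ] F) = x ⊗ₜ[ℝ] y) :
    ¬ IsPerfect (tensorLattice L M) := by
  obtain ⟨B, hB⟩ := exists_basis_tensorLattice L M (Module.finBasis ℤ L) (Module.finBasis ℤ M)
  rw [IsPerfect, perfectionRank_eq _ B, finrank_eq_card_basis B]
  let i₀ : Fin (finrank ℤ L) := ⟨0, by omega⟩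
  let i₁ : Fin (finrank ℤ L) := ⟨1, by omega⟩
  let j₀ : Fin (finrank ℤ M) := ⟨0, by omega⟩
  let j₁ : Fin (finrank ℤ M) := ⟨1, by omega⟩
  have hi : i₀ ≠ i₁ := by simp [i₀, i₁]
  have hj : j₀ ≠ j₁ := by simp [j₀, j₁]
  refine (finrank_lt_card_sym2 (perfectionSpan B) (p := (i₀, j₀)) (q := (i₁, j₁))
    (p' := (i₀, j₁)) (q' := (i₁, j₀)) (by simp [hi, hj]) ?_ ?_).ne
  · intro A hA i j
    induction hA using Submodule.span_induction with
    | mem A h =>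
      obtain ⟨z, -, rfl⟩ := h
      simp [Matrix.vecMulVec_apply, mul_comm]
    | zero => rfl
    | add A A' _ _ h h' => rw [Matrix.add_apply, h, h', Matrix.add_apply]
    | smul r A _ h => rw [Matrix.smul_apply, h, Matrix.smul_apply]
  · intro A hA
    induction hA using Submodule.span_induction with
    | mem A h =>
      obtain ⟨z, hz, rfl⟩ := h
      obtain ⟨x, y, hxy⟩ := hsplit z hz
      simp only [Matrix.vecMulVec_apply, hB z x y hxy]
      ring
    | zero => rfl
    | add A A' _ _ h h' => rw [Matrix.add_apply, h, h', Matrix.add_apply]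
    | smul r A _ h => rw [Matrix.smul_apply, h, Matrix.smul_apply]

end Perfection

/-! ### Failure of extremality by an explicit deformation. -/

section Extreme

variable {V : Type*} [NormedAddCommGroup V] [InnerProductSpace ℝ V] [FiniteDimensional ℝ V]

theorem covolume_map [MeasurableSpace V] [BorelSpace V] (L : Submodule ℤ V) [DiscreteTopology L]
    [IsZLattice ℝ L] {g : V →ₗ[ℝ] V} (hg : LinearMap.det g ≠ 0) :
    ZLattice.covolume (L.map (g.restrictScalars ℤ)) volume
      = |LinearMap.det g| * ZLattice.covolume L volume := by
  let b := Module.finBasis ℤ L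
  let e : V ≃ₗ[ℝ] V := g.equivOfDetNeZero hg
  have he : ∀ x, e x = g x := fun _ => rfl
  let B := b.ofZLatticeBasis ℝ L
  have hL : L.map (g.restrictScalars ℤ) = Submodule.span ℤ (Set.range (B.map e)) := by
    conv_lhs => rw [← b.ofZLatticeBasis_span ℝ, Submodule.map_span, ← Set.range_comp]
    rfl
  rw [hL, ZLattice.covolume_eq_measure_fundamentalDomain _ volume
      (ZSpan.isAddFundamentalDomain (B.map e) _),
    ZLattice.covolume_eq_measure_fundamentalDomain L volume
      (ZLattice.isAddFundamentalDomain b _), ← ZSpan.map_fundamentalDomain, Measure.real,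
    Measure.real]
  have : (e : V → V) '' ZSpan.fundamentalDomain B = g '' ZSpan.fundamentalDomain B := rfl
  rw [this, Measure.addHaar_image_linearMap, ENNReal.toReal_mul,
    ENNReal.toReal_ofReal (abs_nonneg _)]

theorem minNorm_eq {V : Type*} [NormedAddCommGroup V] {L : Submodule ℤ V} {x : V} (hx : x ∈ L) (hx0 : x ≠ 0)
    (h : ∀ y ∈ L, y ≠ 0 → ‖x‖ ≤ ‖y‖) : minNorm L = ‖x‖ := by
  refine IsLeast.csInf_eq ⟨⟨x, hx, hx0, rfl⟩, ?_⟩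
  rintro _ ⟨y, hy, hy0, rfl⟩
  exact h y hy hy0

theorem density_lt_density_map (L : Submodule ℤ V) [DiscreteTopology L] [IsZLattice ℝ L]
    {g : V →ₗ[ℝ] V} (hg0 : 0 < LinearMap.det g) (hg1 : LinearMap.det g < 1)
    (hpos : 0 < minNorm L) (hle : minNorm L ≤ minNorm (L.map (g.restrictScalars ℤ))) :
    density L < density (L.map (g.restrictScalars ℤ)) := by
  let : MeasurableSpace V := borel V
  have : BorelSpace V := ⟨rfl⟩
  have hc := ZLattice.covolume_pos L (volume : Measure V)
  have hb : 0 < (volume : Measure V).real (Metric.ball 0 (minNorm L / 2)) :=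
    ENNReal.toReal_pos (Metric.measure_ball_pos _ _ (by positivity)).ne' measure_ball_lt_top.ne
  have hb' : (volume : Measure V).real (Metric.ball 0 (minNorm L / 2)) ≤
      (volume : Measure V).real (Metric.ball 0 (minNorm (L.map (g.restrictScalars ℤ)) / 2)) :=
    measureReal_mono (Metric.ball_subset_ball (by linarith)) measure_ball_lt_top.ne
  change _ / ZLattice.covolume L volume < _ / ZLattice.covolume (L.map _) volume
  rw [covolume_map L hg0.ne', abs_of_pos hg0]
  refine lt_of_lt_of_le (div_lt_div_of_pos_left hb (by positivity) ?_)
    (div_le_div_of_nonneg_right hb' (by positivity))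
  exact mul_lt_of_lt_one_left hc hg1

open Filter Topology in
/-- A lattice is not extreme if it can be deformed along a determinant-decreasing direction that
is orthogonal to the minimal vectors. -/
theorem not_isExtreme_of_inner_eq_zero (L : Submodule ℤ V) [DiscreteTopology L] [IsZLattice ℝ L]
    (hL : L ≠ ⊥) (N : V →L[ℝ] V)
    (hdet : ∀ a : ℝ, 0 < a → a < 1 → 0 < LinearMap.det (LinearMap.id + a • N.toLinearMap) ∧
      LinearMap.det (LinearMap.id + a • N.toLinearMap) < 1)
    (hN : ∀ z ∈ minimalVectors L, inner ℝ (z : V) (N z) = 0) : ¬ IsExtreme L := by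
  intro hext
  obtain ⟨x₀, hx₀, hx₀', hmin⟩ := exists_minimal L hL
  have hx₀n : 0 < ‖x₀‖ := norm_pos_iff.2 hx₀'
  obtain ⟨S, hS, hgap⟩ := exists_norm_gap L ‖x₀‖
  have h1 : Tendsto (fun a : ℝ => ContinuousLinearMap.id ℝ V + a • N) (𝓝[>] 0)
      (𝓝 (ContinuousLinearMap.id ℝ V)) := by
    have : Continuous fun a : ℝ => ContinuousLinearMap.id ℝ V + a • N := by fun_prop
    have h := this.tendsto 0
    rw [zero_smul, add_zero] at h
    exact h.mono_left nhdsWithin_le_nhds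
  -- Non-minimal nonzero vectors have norm at least `S > ‖x₀‖`; for small `a` their images remain
  -- longer than `x₀`.
  have h2 : ∀ᶠ a : ℝ in 𝓝[>] 0, ‖x₀‖ < S * (1 - a * ‖N‖) := by
    have : Continuous fun a : ℝ => S * (1 - a * ‖N‖) := by fun_prop
    have h := this.tendsto 0
    rw [zero_mul, sub_zero, mul_one] at h
    exact nhdsWithin_le_nhds (h.eventually_const_lt hS)
  obtain ⟨a, ⟨⟨h3, h4⟩, ha0⟩, ha1⟩ := (((h1.eventually hext).and h2).and
    (self_mem_nhdsWithin)).and (nhdsWithin_le_nhds (eventually_lt_nhds zero_lt_one)) |>.exists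
  have ha0 : 0 < a := ha0
  set g : V →ₗ[ℝ] V := LinearMap.id + a • N.toLinearMap with hg
  have hgx : ∀ x, g x = x + a • N x := fun _ => rfl
  have hNa : ∀ x, ‖x‖ * (1 - a * ‖N‖) ≤ ‖g x‖ := by
    intro x
    have h5 : ‖a • N x‖ ≤ a * (‖N‖ * ‖x‖) := by
      rw [norm_smul, Real.norm_of_nonneg ha0.le]
      exact mul_le_mul_of_nonneg_left (N.le_opNorm x) ha0.le
    have h6 := norm_sub_le (x + a • N x) (a • N x)
    rw [add_sub_cancel_right] at h6
    rw [hgx]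
    linarith
  have hle : ∀ x ∈ L, x ≠ 0 → ‖x₀‖ ≤ ‖g x‖ := by
    intro x hx hx0
    rcases (hmin x hx hx0).eq_or_lt with h5 | h5
    · have h6 : inner ℝ x (N x) = 0 := hN ⟨x, hx⟩
        ⟨fun h => hx0 (congrArg Subtype.val h), fun y hy => by
          have := hmin y y.2 (fun h => hy (Subtype.ext h))
          rw [h5] at this
          exact this⟩
      rw [h5]
      -- The first-order term vanishes: `‖g x‖² = ‖x‖² + a² ‖N x‖²`.
      refine le_of_sq_le_sq ?_ (norm_nonneg _)
      rw [hgx, norm_add_sq_real, inner_smul_right, h6]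
      nlinarith [sq_nonneg ‖a • N x‖]
    · have h6 := hgap x hx h5
      have h7 : 0 < 1 - a * ‖N‖ := by
        by_contra hn
        nlinarith
      exact h4.le.trans ((mul_le_mul_of_nonneg_right h6 h7.le).trans (hNa x))
  obtain ⟨hd0, hd1⟩ := hdet a ha0 ha1
  have hmn : minNorm L = ‖x₀‖ := minNorm_eq hx₀ hx₀' hmin
  have hgi : ∀ x, g x = 0 → x = 0 := fun x hx =>
    (g.equivOfDetNeZero hd0.ne').map_eq_zero_iff.1 hx
  have hlt := density_lt_density_map L hd0 hd1 (hmn ▸ hx₀n) (by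
    rw [hmn]
    refine le_csInf ⟨_, g x₀, Submodule.mem_map_of_mem hx₀, fun h => hx₀' (hgi _ h), rfl⟩ ?_
    rintro _ ⟨_, ⟨y, hy, rfl⟩, hy0, rfl⟩
    exact hle y hy fun h => hy0 (by rw [h, map_zero]))
  have h8 : density (L.map (g.restrictScalars ℤ))
      ≤ density (L.map ((LinearMap.id : V →ₗ[ℝ] V).restrictScalars ℤ)) := h3
  have h9 : L.map ((LinearMap.id : V →ₗ[ℝ] V).restrictScalars ℤ) = L := Submodule.map_id L
  rw [h9] at h8
  exact absurd hlt (not_lt.2 h8)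

/-- By orthogonality `g` is a composite of four maps `z ↦ z + c ⟪w, z⟫ w`, each of determinant `1 +
c ‖w‖² = 1 + 2c`. -/
theorem det_id_add_of_orthogonal {w₁ w₂ w₃ w₄ : V} (h₁ : inner ℝ w₁ w₁ = (2 : ℝ))
    (h₂ : inner ℝ w₂ w₂ = (2 : ℝ)) (h₃ : inner ℝ w₃ w₃ = (2 : ℝ)) (h₄ : inner ℝ w₄ w₄ = (2 : ℝ))
    (h₁₂ : inner ℝ w₁ w₂ = (0 : ℝ)) (h₁₃ : inner ℝ w₁ w₃ = (0 : ℝ))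
    (h₁₄ : inner ℝ w₁ w₄ = (0 : ℝ)) (h₂₃ : inner ℝ w₂ w₃ = (0 : ℝ))
    (h₂₄ : inner ℝ w₂ w₄ = (0 : ℝ)) (h₃₄ : inner ℝ w₃ w₄ = (0 : ℝ)) (c₁ c₂ c₃ c₄ : ℝ)
    {g : V →ₗ[ℝ] V} (hg : ∀ z, g z = z + (c₁ * inner ℝ w₁ z) • w₁ + (c₂ * inner ℝ w₂ z) • w₂
      + (c₃ * inner ℝ w₃ z) • w₃ + (c₄ * inner ℝ w₄ z) • w₄) :
    LinearMap.det g = (1 + 2 * c₁) * (1 + 2 * c₂) * (1 + 2 * c₃) * (1 + 2 * c₄) := by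
  let T : V → ℝ → V →ₗ[ℝ] V := fun w c => LinearMap.transvection (innerₗ V w) (c • w)
  have hT : ∀ w c z, T w c z = z + (c * inner ℝ w z) • w := fun w c z => by
    simp [T, LinearMap.transvection.apply, smul_smul, mul_comm]
  have hdet : ∀ w c, inner ℝ w w = (2 : ℝ) → LinearMap.det (T w c) = 1 + 2 * c := by
    intro w c h
    simp only [T, LinearMap.transvection.det, map_smul, innerₗ_apply_apply, h, smul_eq_mul]
    ring
  have : g = T w₁ c₁ ∘ₗ T w₂ c₂ ∘ₗ T w₃ c₃ ∘ₗ T w₄ c₄ := by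
    ext z
    simp only [LinearMap.comp_apply, hT, hg, inner_add_right, inner_smul_right, h₁₂, h₁₃, h₁₄,
      h₂₃, h₂₄, h₃₄, mul_zero, add_zero]
    abel
  rw [this, LinearMap.det_comp, LinearMap.det_comp, LinearMap.det_comp, hdet _ _ h₁, hdet _ _ h₂,
    hdet _ _ h₃, hdet _ _ h₄]
  ring

/-- The self-adjoint map with diagonal coefficients `1, -1, -1, 1` on four orthogonal vectors. -/
theorem exists_trace_zero_of_orthogonal {w₁ w₂ w₃ w₄ : V} (h₁ : inner ℝ w₁ w₁ = (2 : ℝ))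
    (h₂ : inner ℝ w₂ w₂ = (2 : ℝ)) (h₃ : inner ℝ w₃ w₃ = (2 : ℝ)) (h₄ : inner ℝ w₄ w₄ = (2 : ℝ))
    (h₁₂ : inner ℝ w₁ w₂ = (0 : ℝ)) (h₁₃ : inner ℝ w₁ w₃ = (0 : ℝ))
    (h₁₄ : inner ℝ w₁ w₄ = (0 : ℝ)) (h₂₃ : inner ℝ w₂ w₃ = (0 : ℝ))
    (h₂₄ : inner ℝ w₂ w₄ = (0 : ℝ)) (h₃₄ : inner ℝ w₃ w₄ = (0 : ℝ)) :
    ∃ N : V →L[ℝ] V, (∀ z, inner ℝ z (N z) = (1 / 2 : ℝ) * ((inner ℝ w₁ z : ℝ) ^ 2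
        - (inner ℝ w₂ z : ℝ) ^ 2 - (inner ℝ w₃ z : ℝ) ^ 2 + (inner ℝ w₄ z : ℝ) ^ 2)) ∧
      ∀ a : ℝ, LinearMap.det (LinearMap.id + a • N.toLinearMap) = (1 - a ^ 2) ^ 2 := by
  let P : V → V →L[ℝ] V := fun w => (innerSL ℝ w).smulRight w
  have hP : ∀ w z, P w z = (inner ℝ w z : ℝ) • w := fun w z => by simp [P]
  -- As `‖wᵢ‖² = 2`, the factor `1/2` makes each term plus or minus an orthogonal projection.
  refine ⟨(1 / 2 : ℝ) • (P w₁ - P w₂ - P w₃ + P w₄), fun z => ?_, fun a => ?_⟩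
  · rw [real_inner_comm]
    simp only [smul_apply, add_apply, sub_apply, hP, real_inner_smul_left, inner_add_left,
      inner_sub_left]
    ring
  · rw [det_id_add_of_orthogonal h₁ h₂ h₃ h₄ h₁₂ h₁₃ h₁₄ h₂₃ h₂₄ h₃₄
      (c₁ := a / 2) (c₂ := -(a / 2)) (c₃ := -(a / 2)) (c₄ := a / 2)]
    · ring
    · intro z
      simp only [LinearMap.add_apply, LinearMap.smul_apply, LinearMap.id_apply,
        ContinuousLinearMap.coe_coe, smul_apply, add_apply, sub_apply, hP]
      module

variable {E F : Type*} [NormedAddCommGroup E] [InnerProductSpace ℝ E]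
  [NormedAddCommGroup F] [InnerProductSpace ℝ F] [FiniteDimensional ℝ E] [FiniteDimensional ℝ F]

theorem exists_orthonormal_pair (h : 2 ≤ finrank ℝ E) :
    ∃ u v : E, inner ℝ u u = (1 : ℝ) ∧ inner ℝ v v = (1 : ℝ) ∧ inner ℝ u v = (0 : ℝ) := by
  let b := stdOrthonormalBasis ℝ E
  refine ⟨b ⟨0, by omega⟩, b ⟨1, by omega⟩, ?_, ?_, ?_⟩ <;>
    simp [b.inner_eq_ite]

/-- The map `(u ∧ v) ⊗ (s ∧ t)` for orthonormal pairs `u, v` and `s, t`, in diagonal form. -/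
theorem exists_deformation (hE : 2 ≤ finrank ℝ E) (hF : 2 ≤ finrank ℝ F) :
    ∃ N : E ⊗[ℝ] F →L[ℝ] E ⊗[ℝ] F, (∀ x y, inner ℝ (x ⊗ₜ[ℝ] y) (N (x ⊗ₜ[ℝ] y)) = (0 : ℝ)) ∧
      ∀ a : ℝ, LinearMap.det (LinearMap.id + a • N.toLinearMap) = (1 - a ^ 2) ^ 2 := by
  obtain ⟨u, v, huu, hvv, huv⟩ := exists_orthonormal_pair hE
  obtain ⟨s, t, hss, htt, hst⟩ := exists_orthonormal_pair hF
  have hvu : inner ℝ v u = (0 : ℝ) := by rw [real_inner_comm, huv]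
  have hts : inner ℝ t s = (0 : ℝ) := by rw [real_inner_comm, hst]
  -- For these `wᵢ`, polarization turns `⟪z, N z⟫` into `2(⟪u⊗s, z⟫⟪v⊗t, z⟫ - ⟪u⊗t, z⟫⟪v⊗s, z⟫)`,
  -- twice a minor that vanishes on split tensors.
  obtain ⟨N, hN, hdet⟩ := exists_trace_zero_of_orthogonal
    (w₁ := u ⊗ₜ[ℝ] s + v ⊗ₜ[ℝ] t) (w₂ := u ⊗ₜ[ℝ] s - v ⊗ₜ[ℝ] t)
    (w₃ := u ⊗ₜ[ℝ] t + v ⊗ₜ[ℝ] s) (w₄ := u ⊗ₜ[ℝ] t - v ⊗ₜ[ℝ] s)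
    (by simp only [inner_add_right, inner_add_left, inner_tmul, *]; norm_num)
    (by simp only [inner_sub_right, inner_sub_left, inner_tmul, *]; norm_num)
    (by simp only [inner_add_right, inner_add_left, inner_tmul, *]; norm_num)
    (by simp only [inner_sub_right, inner_sub_left, inner_tmul, *]; norm_num)
    (by simp only [inner_sub_right, inner_add_left, inner_tmul, *]; norm_num)
    (by simp only [inner_add_right, inner_add_left, inner_tmul, *]; norm_num)
    (by simp only [inner_sub_right, inner_add_left, inner_tmul, *]; norm_num)
    (by simp only [inner_add_right, inner_sub_left, inner_tmul, *]; norm_num)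
    (by simp only [inner_sub_right, inner_sub_left, inner_tmul, *]; norm_num)
    (by simp only [inner_sub_right, inner_add_left, inner_tmul, *]; norm_num)
  refine ⟨N, fun x y => ?_, hdet⟩
  rw [hN]
  simp only [inner_sub_left, inner_add_left, inner_tmul]
  ring

theorem not_isExtreme_tensorLattice
    (L : Submodule ℤ E) [DiscreteTopology L] [IsZLattice ℝ L]
    (M : Submodule ℤ F) [DiscreteTopology M] [IsZLattice ℝ M]
    (hL : 2 ≤ finrank ℤ L) (hM : 2 ≤ finrank ℤ M)
    (hsplit : ∀ z ∈ minimalVectors (tensorLattice L M), ∃ x y, (z : E ⊗[ℝ] F) = x ⊗ₜ[ℝ] y) :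
    ¬ IsExtreme (tensorLattice L M) := by
  rw [ZLattice.rank ℝ L] at hL
  rw [ZLattice.rank ℝ M] at hM
  obtain ⟨N, hN, hdet⟩ := exists_deformation hL hM
  refine not_isExtreme_of_inner_eq_zero _ (fun h => ?_) N (fun a ha0 ha1 => ?_) fun z hz => ?_
  · have h1 := ZLattice.rank ℝ (tensorLattice L M)
    rw [h, finrank_bot, finrank_tensorProduct] at h1
    exact absurd h1.symm (Nat.mul_ne_zero (by omega) (by omega))
  · have h1 : 0 < 1 - a ^ 2 := by nlinarith
    have h2 : 1 - a ^ 2 < 1 := by nlinarith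
    rw [hdet]
    exact ⟨by positivity, pow_lt_one₀ h1.le h2 two_ne_zero⟩
  · obtain ⟨x, y, hxy⟩ := hsplit z hz
    rw [hxy]
    exact hN x y

end Extreme

end EuclideanLattice

open EuclideanLattice in
theorem mainTheorem11 {E F : Type*}
    [NormedAddCommGroup E] [InnerProductSpace ℝ E] [FiniteDimensional ℝ E]
    [NormedAddCommGroup F] [InnerProductSpace ℝ F] [FiniteDimensional ℝ F]
    (L : Submodule ℤ E) [DiscreteTopology L] [IsZLattice ℝ L]
    (M : Submodule ℤ F) [DiscreteTopology M] [IsZLattice ℝ M]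
    (hL : 2 ≤ Module.finrank ℤ L) (hM : 2 ≤ Module.finrank ℤ M)
    (h : Module.finrank ℤ L ≤ 43 ∨ Module.finrank ℤ M ≤ 43) :
    ¬ IsPerfect (tensorLattice L M) ∧ ¬ IsExtreme (tensorLattice L M) := by
  have hsplit : ∀ z ∈ minimalVectors (tensorLattice L M),
      ∃ x y, (z : E ⊗[ℝ] F) = x ⊗ₜ[ℝ] y := fun z hz => by
    obtain ⟨x, -, y, -, hxy⟩ := exists_eq_tmul_of_mem_minimalVectors L M h hz
    exact ⟨x, y, hxy⟩
  exact ⟨not_isPerfect_tensorLattice L M hL hM hsplit,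
    not_isExtreme_tensorLattice L M hL hM hsplit⟩
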